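/- Let $S\subset\mathbb R^N$ be compact and let $\mathcal M(S)^N$ be the space of $\mathbb R^N$-valued finite Borel measures on $S$, with total variation norm $\|\mu\|_{TV}=|\mu|(S)$ (computed with the Euclidean norm on $\mathbb R^N$). It is paired with $C(S)^N$ by $\langle\varphi,\mu\rangle=\int\varphi\cdot d\mu$, which defines the weak-star topology on it; $\|\varphi\|_\infty=\max_S|\varphi|$ on $C(S)^N$. For $\mu\in\mathcal M(S)^N$ let $u_\mu=d\mu/d|\mu|$ be its polar density. Let $\mathcal H$ be a real Hilbert space and $A:\mathcal M(S)^N\to\mathcal H$ a linear operator that is continuous from the weak-star topology to the weak topology of $\mathcal H$, and let $A^*:\mathcal H\to C(S)^N$ be its dual, $\langle A^*h,\mu\rangle=\langle h,A\mu\rangle_{\mathcal H}$. Let $\lambda>0$, $f\in\mathcal H$, and $\mathcal F(\mu)=\|f-A\mu\|_{\mathcal H}^2+\lambda\|\mu\|_{TV}$. (1) Let $V\subset\mathcal M(S)^N$ be a weak-star closed linear subspace, $V^\perp=\{p\in C(S)^N:\langle p,\nu\rangle=0\ \forall\nu\in V\}$, and let $\mu\in V$, where it is not the case that both $\mu=0$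 and $V=\mathcal M(S)^N$. Then $\mu$ minimizes $\mathcal F$ over $V$ if and only if there is a sequence $(p_n)_{n\in\mathbb N}\subset V^\perp$ such that $$A^*(f-A\mu)+p_n\to\tfrac{\lambda}{2}u_\mu\ \text{ in }L^1(|\mu|)^N\quad\text{and}\quad \|A^*(f-A\mu)+p_n\|_\infty\to\tfrac{\lambda}{2}.$$ If $\mu=0$ and $V=\mathcal M(S)^N$, the existence of such a sequence still implies that $\mu$ minimizes $\mathcal F$ over $V$. (2) Let $(\nu_k)_{k\in I}$, $I\subset\mathbb N$, be mutually singular Borel probability measures on $S$, let $V$ be the space of all measures $\sum_{k\in I}m_k\nu_k$ with $m_k\in\mathbb R^N$ and $\sum_{k\in I}|m_k|<\infty$ (a GSM space), and let $\mu\in V$. Then $\mu$ minimizes $\mathcal F$ over $V$ if and only if there is a Borel function $p:S\to\mathbb R^N$ in $L^\infty(\sum_k\nu_k)^N$ with $\int p\cdot d\eta=0$ for all $\eta\in V$ (that is, $p$ annihilates $V$) such that $$A^*(f-A\mu)+p=\tfrac{\lambda}{2}u_\mu\quad|\mu|\text{-a.e.}\qquad\text{and}\qquad \sup_{x\in S}|A^*(f-A\mu)(x)+p(x)|\le\tfrac{\lambda}{2}.$$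 -/

import Mathlib

open MeasureTheory Filter Topology
open scoped ENNReal

noncomputable section

namespace TVReg

/-- `ℝᴺ` with its Euclidean norm. -/
abbrev E (N : ℕ) : Type := EuclideanSpace ℝ (Fin N)

section Measurable

variable {X : Type*} [MeasurableSpace X] {N : ℕ}

/-- The `i`-th component of an `ℝᴺ`-valued measure, a finite signed measure. -/
def component (μ : VectorMeasure X (E N)) (i : Fin N) : SignedMeasure X :=
  μ.mapRange (EuclideanSpace.proj i : E N →L[ℝ] ℝ).toLinearMap.toAddMonoidHom
    (EuclideanSpace.proj i : E N →L[ℝ] ℝ).continuous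

theorem component_apply (μ : VectorMeasure X (E N)) (i : Fin N) (s : Set X) :
    component μ i s = μ s i := rfl

/-- The variation of an `ℝᴺ`-valued measure is a finite measure. -/
instance instIsFiniteMeasureVariation (μ : VectorMeasure X (E N)) :
    IsFiniteMeasure μ.variation := by
  have key : μ.variation ≤ Measure.sum fun i => (component μ i).totalVariation := by
    refine VectorMeasure.variation_le_of_forall_enorm_le fun s hs => ?_
    rw [Measure.sum_apply _ hs, tsum_fintype]
    have h1 : ‖μ s‖ₑ ≤ ∑ i, ‖component μ i s‖ₑ := by
      have h2 : ‖μ s‖ ≤ ∑ i, ‖component μ i s‖ := by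
        have h3 : μ s = ∑ i, (component μ i s) • EuclideanSpace.single i (1 : ℝ) := by
          ext j
          simp [component_apply, Pi.single_apply]
        calc ‖μ s‖ = ‖∑ i, (component μ i s) • EuclideanSpace.single i (1 : ℝ)‖ := by rw [← h3]
          _ ≤ ∑ i, ‖(component μ i s) • EuclideanSpace.single i (1 : ℝ)‖ := norm_sum_le _ _
          _ = ∑ i, ‖component μ i s‖ := by simp [norm_smul]
      simp only [← ofReal_norm]
      rw [← ENNReal.ofReal_sum_of_nonneg fun _ _ => norm_nonneg _]
      exact ENNReal.ofReal_le_ofReal h2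
    exact h1.trans (Finset.sum_le_sum fun i _ => SignedMeasure.enorm_le_totalVariation _ _)
  refine ⟨lt_of_le_of_lt (key Set.univ) ?_⟩
  rw [Measure.sum_apply _ MeasurableSet.univ, tsum_fintype]
  exact ENNReal.sum_lt_top.2 fun i _ => measure_lt_top _ _

/-- The total variation norm `‖μ‖_TV = |μ|(X)`; the measure `|μ|` is `μ.variation`. -/
def tvNorm (μ : VectorMeasure X (E N)) : ℝ := μ.variation.real Set.univ

/-- The polar density `u_μ = dμ/d|μ|`, componentwise as a Radon–Nikodym derivative. -/
def polarDensity (μ : VectorMeasure X (E N)) (x : X) : E N :=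
  WithLp.toLp 2 fun i => (component μ i).rnDeriv μ.variation x

/-- The integral `∫ φ · dμ` of an `ℝᴺ`-valued function against an `ℝᴺ`-valued measure,
where the dot is the Euclidean inner product. -/
def dotIntegral (μ : VectorMeasure X (E N)) (φ : X → E N) : ℝ :=
  VectorMeasure.integral μ φ (innerSL ℝ)

/-- The space generated by the measures `ν k`: all `ℝᴺ`-valued measures of the form
`∑ₖ mₖ νₖ` with `mₖ ∈ ℝᴺ` and `∑ₖ |mₖ| < ∞`. It is used for a countable family of mutually
singular probability measures. -/
def generatedSpace (N : ℕ) {I : Set ℕ} (ν : I → Measure X) :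
    Submodule ℝ (VectorMeasure X (E N)) where
  carrier := {μ | ∃ m : I → E N, Summable (fun k => ‖m k‖) ∧
    ∀ s, MeasurableSet s → HasSum (fun k => (ν k).real s • m k) (μ s)}
  zero_mem' := ⟨0, by simp, fun s _ => by simp⟩
  add_mem' := by
    rintro μ μ' ⟨m, hm, h⟩ ⟨m', hm', h'⟩
    refine ⟨m + m', (hm.add hm').of_nonneg_of_le (fun _ => norm_nonneg _)
      (fun _ => norm_add_le _ _), fun s hs => ?_⟩
    simpa [smul_add] using (h s hs).add (h' s hs)
  smul_mem' := by
    rintro c μ ⟨m, hm, h⟩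
    refine ⟨c • m, by simpa [norm_smul] using hm.mul_left |c|, fun s hs => ?_⟩
    have h1 : (fun k => (ν k).real s • (c • m) k) = fun k => c • ((ν k).real s • m k) :=
      funext fun k => smul_comm ((ν k).real s) c (m k)
    rw [h1]
    exact (h s hs).const_smul c

end Measurable

section Duality

variable {X : Type*} [TopologicalSpace X] [CompactSpace X] [MeasurableSpace X] [BorelSpace X]
variable {N : ℕ}

theorem integrable_continuousMap (μ : VectorMeasure X (E N)) (φ : C(X, E N)) :
    μ.Integrable φ :=
  φ.continuous.integrable_of_hasCompactSupport (HasCompactSupport.of_compactSpace _)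

/-- The duality pairing `⟨φ, μ⟩ = ∫ φ · dμ` between vector measures and continuous functions. -/
def pairing (X : Type*) [TopologicalSpace X] [CompactSpace X] [MeasurableSpace X] [BorelSpace X]
    (N : ℕ) : VectorMeasure X (E N) →ₗ[ℝ] C(X, E N) →ₗ[ℝ] ℝ :=
  LinearMap.mk₂ ℝ (fun μ φ => dotIntegral μ φ)
    (fun μ ν φ => VectorMeasure.integral_add_vectorMeasure
      (integrable_continuousMap μ φ) (integrable_continuousMap ν φ))
    (fun c _ _ => VectorMeasure.integral_smul_vectorMeasure _ c)
    (fun μ φ ψ => VectorMeasure.integral_add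
      (integrable_continuousMap μ φ) (integrable_continuousMap μ ψ))
    (fun c μ φ => VectorMeasure.integral_smul φ μ (innerSL ℝ) c)

/-- The weak-star topology on vector measures: the coarsest topology that makes
`μ ↦ ∫ φ · dμ` continuous for each continuous `φ`. -/
abbrev weakStar (X : Type*) [TopologicalSpace X] [CompactSpace X] [MeasurableSpace X]
    [BorelSpace X] (N : ℕ) : TopologicalSpace (VectorMeasure X (E N)) :=
  WeakBilin.instTopologicalSpace (pairing X N)

/-- The annihilator `V^⊥` of `V` in the space of continuous functions. -/
def annihilator (V : Submodule ℝ (VectorMeasure X (E N))) : Submodule ℝ C(X, E N) where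
  carrier := {p | ∀ ν ∈ V, pairing X N ν p = 0}
  zero_mem' := fun ν _ => map_zero _
  add_mem' := fun hp hq ν hν => by rw [map_add, hp ν hν, hq ν hν, add_zero]
  smul_mem' := fun c p hp ν hν => by rw [map_smul, hp ν hν, smul_zero]

variable {H : Type*} [NormedAddCommGroup H] [InnerProductSpace ℝ H]

/-- `A` is continuous from the weak-star topology to the weak topology of the Hilbert space. -/
def WeakStarContinuous (A : VectorMeasure X (E N) →ₗ[ℝ] H) : Prop :=
  ∀ h : H, Continuous[weakStar X N, inferInstance] fun μ => inner ℝ h (A μ)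

/-- A continuous function is determined by its integrals against vector measures. -/
theorem pairing_ext {φ ψ : C(X, E N)} (h : ∀ μ, pairing X N μ φ = pairing X N μ ψ) : φ = ψ := by
  ext1 x
  refine ext_inner_right ℝ fun v => ?_
  have h1 : ∀ χ : C(X, E N), pairing X N (VectorMeasure.dirac x v) χ = inner ℝ (χ x) v := by
    intro χ
    have := VectorMeasure.integral_dirac' (a := x) (v := v) (B := innerSL ℝ)
      χ.continuous.measurable.stronglyMeasurable
    exact this
  rw [← h1, ← h1, h]

/-- A weak-star continuous operator has a unique dual with values in the continuous functions. -/
theorem existsUnique_adjoint {A : VectorMeasure X (E N) →ₗ[ℝ] H} (hA : WeakStarContinuous A) (h : H) :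
    ∃! φ : C(X, E N), ∀ μ, pairing X N μ φ = inner ℝ h (A μ) := by
  let L : StrongDual ℝ (WeakBilin (pairing X N)) :=
    ⟨((innerSL ℝ h : H →L[ℝ] ℝ).toLinearMap ∘ₗ A : VectorMeasure X (E N) →ₗ[ℝ] ℝ), hA h⟩
  obtain ⟨φ, hφ⟩ := LinearMap.dualEmbedding_surjective (pairing X N) L
  have hφ' : ∀ μ, pairing X N μ φ = inner ℝ h (A μ) := fun μ => DFunLike.congr_fun hφ μ
  exact ⟨φ, hφ', fun ψ hψ => pairing_ext fun μ => (hψ μ).trans (hφ' μ).symm⟩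

/-- The dual operator `A^*`: `A^* h` is the (unique) continuous function with
`⟨A^* h, μ⟩ = ⟨h, A μ⟩` for all `μ`. -/
def adjoint {A : VectorMeasure X (E N) →ₗ[ℝ] H} (hA : WeakStarContinuous A) (h : H) : C(X, E N) :=
  (existsUnique_adjoint hA h).choose

theorem pairing_adjoint {A : VectorMeasure X (E N) →ₗ[ℝ] H} (hA : WeakStarContinuous A) (h : H)
    (μ : VectorMeasure X (E N)) : pairing X N μ (adjoint hA h) = inner ℝ h (A μ) :=
  (existsUnique_adjoint hA h).choose_spec.1 μ

end Duality

/-- The functional `‖f - A μ‖² + λ ‖μ‖_TV`. -/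
def objective {X : Type*} [MeasurableSpace X] {N : ℕ} {H : Type*} [NormedAddCommGroup H]
    [InnerProductSpace ℝ H] (A : VectorMeasure X (E N) →ₗ[ℝ] H) (lam : ℝ) (f : H)
    (μ : VectorMeasure X (E N)) : ℝ :=
  ‖f - A μ‖ ^ 2 + lam * tvNorm μ

/-- There are `pₙ ∈ V^⊥` such that `A^*(f - A μ) + pₙ → (λ/2) u_μ` in `L¹(|μ|)` and
`‖A^*(f - A μ) + pₙ‖_∞ → λ/2`. -/
def ApproxCriticalPoint {X : Type*} [TopologicalSpace X] [CompactSpace X] [MeasurableSpace X]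
    [BorelSpace X] {N : ℕ} {H : Type*} [NormedAddCommGroup H] [InnerProductSpace ℝ H]
    {A : VectorMeasure X (E N) →ₗ[ℝ] H} (hA : WeakStarContinuous A) (lam : ℝ) (f : H)
    (V : Submodule ℝ (VectorMeasure X (E N))) (μ : VectorMeasure X (E N)) : Prop :=
  ∃ p : ℕ → C(X, E N), (∀ n, p n ∈ annihilator V) ∧
    Tendsto (fun n => eLpNorm (fun x => adjoint hA (f - A μ) x + p n x -
      (lam / 2) • polarDensity μ x) 1 μ.variation) atTop (𝓝 0) ∧
    Tendsto (fun n => ‖adjoint hA (f - A μ) + p n‖) atTop (𝓝 (lam / 2))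

end TVReg

end

noncomputable section

namespace TVReg

/-! ### Polar decomposition, and integration against a vector measure -/

section PolarDecomposition

variable {X : Type*} [MeasurableSpace X] {N : ℕ}

/-! Write `q = A^*(f - A μ)`. Since the objective is a quadratic plus a convex, positively
homogeneous term, `μ` is optimal on `V` exactly when `⟨q, ν⟩ ≤ (λ/2)‖ν‖` for all `ν ∈ V`, with
equality at `ν = μ` (`isMinOn_objective_iff`). Adding an annihilator of `V` to `q` changes none of
these pairings.

If `V` is weak-star closed, Riesz representation and Hahn–Banach identify it with the dual of `C(X,
E N) ⧸ annihilator V`. The inequality then bounds the quotient norm of `q` by `λ/2`, so some `p ∈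
V^⊥` bring `‖q + p‖` below `λ/2 + ε` (`exists_mem_annihilator_norm_add_lt`). A function of norm at
most `C` near `λ/2` whose pairing with `μ` is `(λ/2)‖μ‖` must nearly equal `(λ/2) u_μ`, because `∫
|g - c u_μ|² d|μ| ≤ (C² + c²)‖μ‖ - 2c⟨g, μ⟩`. This yields the `L¹` convergence.

For mutually singular generators no approximation is needed: replacing `q` by its `ν k`-mean on a
set carrying `ν k` gives `q + p` explicitly, with norm at most `λ/2`, and the same estimate with `C
= c = λ/2` gives equality almost everywhere. -/

theorem component_absolutelyContinuous (μ : VectorMeasure X (E N)) (i : Fin N) :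
    component μ i ≪ᵥ μ.variation.toENNRealVectorMeasure := by
  refine VectorMeasure.AbsolutelyContinuous.mk fun s hs h => ?_
  rw [Measure.toENNRealVectorMeasure_apply_measurable hs] at h
  have h1 : ‖μ s‖ₑ = 0 := le_antisymm ((μ.enorm_measure_le_variation s).trans h.le) zero_le
  rw [component_apply, enorm_eq_zero.1 h1]
  rfl

theorem integrable_polarDensity (μ : VectorMeasure X (E N)) :
    Integrable (polarDensity μ) μ.variation := by
  have h : Integrable (fun x i => (component μ i).rnDeriv μ.variation x) μ.variation :=
    Integrable.of_eval fun i => SignedMeasure.integrable_rnDeriv _ _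
  exact (PiLp.continuousLinearEquiv 2 ℝ fun _ : Fin N => ℝ).symm.toContinuousLinearMap.integrable_comp h

theorem withDensityᵥ_polarDensity (μ : VectorMeasure X (E N)) :
    μ.variation.withDensityᵥ (polarDensity μ) = μ := by
  ext1 s hs
  rw [withDensityᵥ_apply (integrable_polarDensity μ) hs]
  ext i
  have h := (EuclideanSpace.proj i : E N →L[ℝ] ℝ).integral_comp_comm
    ((integrable_polarDensity μ).restrict (s := s))
  refine h.symm.trans ?_
  have h1 := congrArg (fun ν : SignedMeasure X => ν s)
    (SignedMeasure.withDensityᵥ_rnDeriv_eq _ _ (component_absolutelyContinuous μ i))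
  rw [withDensityᵥ_apply (SignedMeasure.integrable_rnDeriv _ _) hs] at h1
  exact h1

/-- The variation of `u|μ|` is `‖u‖ |μ|`; as `u|μ| = μ`, this is `|μ|` itself, and uniqueness of
densities gives `‖u‖ = 1`. -/
theorem norm_polarDensity_ae (μ : VectorMeasure X (E N)) :
    ∀ᵐ x ∂μ.variation, ‖polarDensity μ x‖ = 1 := by
  have h := Measure.variation_withDensityᵥ (integrable_polarDensity μ)
  rw [withDensityᵥ_polarDensity] at h
  have h1 : μ.variation.withDensity (fun x => ‖polarDensity μ x‖ₑ) =
      μ.variation.withDensity fun _ => 1 := by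
    rw [← h]; exact withDensity_one.symm
  rw [withDensity_eq_iff_of_sigmaFinite (integrable_polarDensity μ).aestronglyMeasurable.enorm
    aemeasurable_const] at h1
  filter_upwards [h1] with x hx
  rw [← toReal_enorm, hx, ENNReal.toReal_one]

theorem dotIntegral_indicator (μ : VectorMeasure X (E N)) {s : Set X} (hs : MeasurableSet s)
    (c : E N) : dotIntegral μ (s.indicator fun _ => c) = inner ℝ c (μ s) :=
  setToFun_indicator_const _ hs (measure_ne_top _ _) c

theorem integrable_inner_of_integrable_withDensity {ρ : Measure X} {g φ : X → E N}
    (hg : Integrable g ρ) (hφ : Integrable φ (ρ.withDensity fun x => ‖g x‖ₑ)) :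
    Integrable (fun x => inner ℝ (φ x) (g x)) ρ ∧
      ∫ x, ‖φ x‖ ∂(ρ.withDensity fun x => ‖g x‖ₑ) = ∫ x, ‖g x‖ * ‖φ x‖ ∂ρ := by
  have hfin : ∀ᵐ x ∂ρ, ‖g x‖ₑ < ∞ := Eventually.of_forall fun x => enorm_lt_top
  have h1 := (integrable_withDensity_iff_integrable_smul₀' hg.aestronglyMeasurable.enorm hfin).1
    hφ
  have h3 : AEStronglyMeasurable (fun x => inner ℝ (φ x) (g x)) ρ := by
    -- Measurability of `φ` is known only for the weighted measure, which ignores the zeros of `g`;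
    -- moving the weight `‖g‖` onto `φ` gives factors measurable for `ρ`.
    have h4 : (fun x => inner ℝ (φ x) (g x)) =
        fun x => inner ℝ (‖g x‖ₑ.toReal • φ x) (‖g x‖⁻¹ • g x) := by
      ext x
      rw [inner_smul_left, inner_smul_right, toReal_enorm]
      by_cases hx : g x = 0
      · simp [hx]
      · have : ‖g x‖ ≠ 0 := norm_ne_zero_iff.2 hx
        simp; field_simp
    rw [h4]
    exact h1.aestronglyMeasurable.inner
      (hg.aestronglyMeasurable.norm.aemeasurable.inv.aestronglyMeasurable.smul
        hg.aestronglyMeasurable)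
  refine ⟨h1.mono h3 (Eventually.of_forall fun x => ?_), ?_⟩
  · rw [norm_smul, toReal_enorm, norm_norm, mul_comm]
    exact norm_inner_le_norm _ _
  · rw [integral_withDensity_eq_integral_toReal_smul₀ hg.aestronglyMeasurable.enorm hfin]
    simp

/-- The integral against a measure with a density. -/
theorem dotIntegral_withDensityᵥ {ρ : Measure X} {g φ : X → E N} (hg : Integrable g ρ)
    (hφ : (ρ.withDensityᵥ g).Integrable φ) :
    dotIntegral (ρ.withDensityᵥ g) φ = ∫ x, inner ℝ (φ x) (g x) ∂ρ := by
  have hvar := Measure.variation_withDensityᵥ hg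
  have hφ' : Integrable φ (ρ.withDensityᵥ g).variation := hφ
  have key : ∀ {φ : X → E N}, Integrable φ (ρ.withDensityᵥ g).variation →
      Integrable (fun x => inner ℝ (φ x) (g x)) ρ ∧
      ∫ x, ‖φ x‖ ∂(ρ.withDensityᵥ g).variation = ∫ x, ‖g x‖ * ‖φ x‖ ∂ρ := by
    rw [hvar]; exact fun h => integrable_inner_of_integrable_withDensity hg h
  have hcongr : ∀ {φ ψ : X → E N}, φ =ᵐ[(ρ.withDensityᵥ g).variation] ψ →
      (fun x => inner ℝ (φ x) (g x)) =ᵐ[ρ] fun x => inner ℝ (ψ x) (g x) := by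
    intro φ ψ h
    rw [hvar, Filter.EventuallyEq, ae_withDensity_iff' hg.aestronglyMeasurable.enorm] at h
    filter_upwards [h] with x hx
    by_cases h0 : g x = 0
    · simp [h0]
    · rw [hx (enorm_ne_zero.2 h0)]
  have hbound : ∀ {φ : X → E N}, Integrable φ (ρ.withDensityᵥ g).variation →
      |∫ x, inner ℝ (φ x) (g x) ∂ρ| ≤ ∫ x, ‖φ x‖ ∂(ρ.withDensityᵥ g).variation := by
    intro φ h
    have h1 := (integrable_withDensity_iff_integrable_smul₀' hg.aestronglyMeasurable.enorm
      (Eventually.of_forall fun x => enorm_lt_top)).1 (hvar ▸ h)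
    rw [(key h).2]
    refine (norm_integral_le_integral_norm _).trans (integral_mono (key h).1.norm ?_ fun x => ?_)
    · simpa [norm_smul] using h1.norm
    · rw [mul_comm]; exact norm_inner_le_norm _ _
  refine Integrable.induction (fun φ : X → E N =>
    dotIntegral (ρ.withDensityᵥ g) φ = ∫ x, inner ℝ (φ x) (g x) ∂ρ) ?_ ?_ ?_ ?_ hφ'
  · intro c s hs _
    rw [dotIntegral_indicator _ hs, withDensityᵥ_apply hg hs, ← integral_inner hg.integrableOn,
      ← integral_indicator hs]
    congr 1; ext x
    by_cases hx : x ∈ s <;> simp [hx]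
  · intro f f' _ hf hf' h h'
    have h1 : dotIntegral (ρ.withDensityᵥ g) (f + f') =
        dotIntegral (ρ.withDensityᵥ g) f + dotIntegral (ρ.withDensityᵥ g) f' :=
      VectorMeasure.integral_add hf hf'
    rw [h1, h, h', ← integral_add (key hf).1 (key hf').1]
    simp [inner_add_left]
  · refine isClosed_eq VectorMeasure.continuous_integral ?_
    -- The right-hand side is 1-Lipschitz in the `L¹` norm of the variation, by `hbound`.
    refine (LipschitzWith.of_dist_le_mul (K := 1) fun a b => ?_).continuous
    have hab := (Lp.coeFn_sub a b)
    have hi : Integrable (a - b : X →₁[(ρ.withDensityᵥ g).variation] E N)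
      (ρ.withDensityᵥ g).variation := L1.integrable_coeFn _
    rw [dist_eq_norm a b, L1.norm_eq_integral_norm, NNReal.coe_one, one_mul, Real.dist_eq,
      ← integral_sub (key (L1.integrable_coeFn a)).1 (key (L1.integrable_coeFn b)).1]
    refine le_trans (le_of_eq ?_) (hbound hi)
    congr 1
    refine integral_congr_ae ?_
    filter_upwards [hcongr hab] with x hx
    rw [hx, Pi.sub_apply, inner_sub_left]
  · intro f f' hff' _ h
    rw [← integral_congr_ae (hcongr hff'), ← h]
    exact (VectorMeasure.integral_congr_ae hff').symm

theorem dotIntegral_eq_integral_inner {μ : VectorMeasure X (E N)} {φ : X → E N}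
    (hφ : μ.Integrable φ) :
    dotIntegral μ φ = ∫ x, inner ℝ (φ x) (polarDensity μ x) ∂μ.variation := by
  have h := dotIntegral_withDensityᵥ (integrable_polarDensity μ) (φ := φ)
  rw [withDensityᵥ_polarDensity] at h
  exact h hφ

theorem tvNorm_nonneg (μ : VectorMeasure X (E N)) : 0 ≤ tvNorm μ := measureReal_nonneg

theorem tvNorm_add_le (μ ν : VectorMeasure X (E N)) : tvNorm (μ + ν) ≤ tvNorm μ + tvNorm ν := by
  have h : (μ + ν).variation Set.univ ≤ (μ.variation + ν.variation) Set.univ :=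
    VectorMeasure.variation_add_le _
  rw [Measure.add_apply] at h
  simp only [tvNorm, measureReal_def]
  rw [← ENNReal.toReal_add (measure_ne_top _ _) (measure_ne_top _ _)]
  exact ENNReal.toReal_mono (by finiteness) h

theorem tvNorm_smul (c : ℝ) (μ : VectorMeasure X (E N)) : tvNorm (c • μ) = |c| * tvNorm μ := by
  simp [tvNorm, measureReal_def, VectorMeasure.variation_smul]

theorem tvNorm_zero : tvNorm (0 : VectorMeasure X (E N)) = 0 := by
  simp [tvNorm]

theorem eq_zero_of_tvNorm_eq_zero {μ : VectorMeasure X (E N)} (h : tvNorm μ = 0) : μ = 0 := by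
  have h1 : μ.variation Set.univ = 0 := by
    simpa [tvNorm, measureReal_def, ENNReal.toReal_eq_zero_iff] using h
  ext1 s hs
  refine enorm_eq_zero.1 (le_antisymm ((μ.enorm_measure_le_variation s).trans ?_) zero_le)
  rw [Measure.measure_univ_eq_zero.1 h1]
  simp

theorem dotIntegral_le_of_norm_le {μ : VectorMeasure X (E N)} {φ : X → E N} {C : ℝ}
    (h : ∀ x, ‖φ x‖ ≤ C) : dotIntegral μ φ ≤ C * tvNorm μ := by
  have hC : ‖(innerSL ℝ : E N →L[ℝ] E N →L[ℝ] ℝ)‖ ≤ 1 := norm_innerSL_le ℝ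
  have := VectorMeasure.norm_integral_le_integral_norm (μ := μ) (f := φ)
    (B := (innerSL ℝ : E N →L[ℝ] E N →L[ℝ] ℝ))
  refine (le_abs_self _).trans (this.trans ?_)
  refine (mul_le_of_le_one_left (integral_nonneg fun _ => norm_nonneg _) hC).trans ?_
  refine (integral_mono_of_nonneg (Eventually.of_forall fun _ => norm_nonneg _)
    (integrable_const C) (Eventually.of_forall h)).trans ?_
  simp [tvNorm, mul_comm]

theorem integrable_of_norm_le {μ : VectorMeasure X (E N)} {φ : X → E N} {C : ℝ}
    (hm : Measurable φ) (h : ∀ x, ‖φ x‖ ≤ C) : μ.Integrable φ :=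
  Integrable.of_bound hm.aestronglyMeasurable C (Eventually.of_forall h)

/-- The squared distance of a bounded function from the scaled polar density. -/
theorem integral_norm_sub_polarDensity_sq_le {μ : VectorMeasure X (E N)} {g : X → E N} {C c : ℝ}
    (hm : Measurable g) (h : ∀ x, ‖g x‖ ≤ C) :
    Integrable (fun x => ‖g x - c • polarDensity μ x‖ ^ 2) μ.variation ∧
    ∫ x, ‖g x - c • polarDensity μ x‖ ^ 2 ∂μ.variation ≤
      (C ^ 2 + c ^ 2) * tvNorm μ - 2 * c * dotIntegral μ g := by
  have hint := integrable_of_norm_le (μ := μ) hm h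
  have hi1 : Integrable (fun x => inner ℝ (g x) (polarDensity μ x)) μ.variation := by
    refine (integrable_const C).mono'
      (hm.aestronglyMeasurable.inner (integrable_polarDensity μ).aestronglyMeasurable) ?_
    filter_upwards [norm_polarDensity_ae μ] with x hx
    exact (norm_inner_le_norm _ _).trans (by rw [hx, mul_one]; exact h x)
  have hmeas : AEStronglyMeasurable (fun x => ‖g x - c • polarDensity μ x‖ ^ 2) μ.variation :=
    (hm.aestronglyMeasurable.sub
      ((integrable_polarDensity μ).aestronglyMeasurable.const_smul c)).norm.pow 2
  have hi2 : Integrable (fun x => (C ^ 2 + c ^ 2) - 2 * c * inner ℝ (g x) (polarDensity μ x))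
      μ.variation := (integrable_const _).sub (hi1.const_mul _)
  have hle : ∀ᵐ x ∂μ.variation, ‖g x - c • polarDensity μ x‖ ^ 2 ≤
      (C ^ 2 + c ^ 2) - 2 * c * inner ℝ (g x) (polarDensity μ x) := by
    filter_upwards [norm_polarDensity_ae μ] with x hx
    have h2 : ‖g x‖ ^ 2 ≤ C ^ 2 := pow_le_pow_left₀ (norm_nonneg _) (h x) 2
    rw [norm_sub_sq_real, norm_smul, hx, inner_smul_right, Real.norm_eq_abs, mul_one, sq_abs]
    linarith
  have hi3 := hi2.mono' hmeas (by
    filter_upwards [hle] with x hx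
    rwa [Real.norm_of_nonneg (by positivity)])
  refine ⟨hi3, (integral_mono_ae hi3 hi2 hle).trans (le_of_eq ?_)⟩
  rw [integral_sub (integrable_const _) (hi1.const_mul _), integral_const_mul,
    dotIntegral_eq_integral_inner hint, integral_const, smul_eq_mul, tvNorm, mul_comm (μ.variation.real _)]

theorem integrable_sub_smul_polarDensity {μ : VectorMeasure X (E N)} {g : X → E N}
    (hg : μ.Integrable g) (c : ℝ) : Integrable (fun x => g x - c • polarDensity μ x) μ.variation :=
  Integrable.sub hg ((integrable_polarDensity μ).smul c)

theorem toReal_eLpNorm_sub_smul_polarDensity {μ : VectorMeasure X (E N)} {g : X → E N}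
    (hg : μ.Integrable g) (c : ℝ) :
    (eLpNorm (fun x => g x - c • polarDensity μ x) 1 μ.variation).toReal =
      ∫ x, ‖g x - c • polarDensity μ x‖ ∂μ.variation := by
  rw [eLpNorm_one_eq_lintegral_enorm, integral_norm_eq_lintegral_enorm
    (integrable_sub_smul_polarDensity hg c).aestronglyMeasurable]

/-- The `L¹` distance of a bounded function from the scaled polar density. -/
theorem eLpNorm_sub_polarDensity_le {μ : VectorMeasure X (E N)} {g : X → E N} {C c s : ℝ}
    (hm : Measurable g) (h : ∀ x, ‖g x‖ ≤ C) (hs : 0 < s) :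
    eLpNorm (fun x => g x - c • polarDensity μ x) 1 μ.variation ≤
      ENNReal.ofReal (s / 2 * tvNorm μ +
        (2 * s)⁻¹ * ((C ^ 2 + c ^ 2) * tvNorm μ - 2 * c * dotIntegral μ g)) := by
  have hd := integrable_sub_smul_polarDensity (integrable_of_norm_le (μ := μ) hm h) c
  obtain ⟨hsqi, hsq⟩ := integral_norm_sub_polarDensity_sq_le (μ := μ) (c := c) hm h
  rw [eLpNorm_one_eq_lintegral_enorm, ← ofReal_integral_norm_eq_lintegral_enorm hd]
  refine ENNReal.ofReal_le_ofReal ?_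
  -- Pointwise `y ≤ s/2 + y²/(2s)`; the free parameter `s` is later matched to the size of the
  -- squared distance.
  have hamgm : ∫ x, ‖g x - c • polarDensity μ x‖ ∂μ.variation ≤
      ∫ x, (s / 2 + (2 * s)⁻¹ * ‖g x - c • polarDensity μ x‖ ^ 2) ∂μ.variation := by
    refine integral_mono hd.norm ((integrable_const _).add (hsqi.const_mul _)) fun x => ?_
    have h1 (y : ℝ) : s / 2 + (2 * s)⁻¹ * y ^ 2 - y = (2 * s)⁻¹ * (y - s) ^ 2 := by
      field_simp
      ring
    have h2 (y : ℝ) : 0 ≤ (2 * s)⁻¹ * (y - s) ^ 2 := by positivity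
    exact sub_nonneg.1 ((h1 _).symm ▸ h2 _)
  rw [integral_add (integrable_const _) (hsqi.const_mul _), integral_const_mul, integral_const,
    smul_eq_mul, mul_comm (μ.variation.real _)] at hamgm
  exact hamgm.trans (add_le_add_right (mul_le_mul_of_nonneg_left hsq (by positivity)) _)

theorem dotIntegral_eq_tvNorm_of_ae_eq {μ : VectorMeasure X (E N)} {g : X → E N} {C c : ℝ}
    (hm : Measurable g) (hC : ∀ x, ‖g x‖ ≤ C)
    (h : ∀ᵐ x ∂μ.variation, g x = c • polarDensity μ x) : dotIntegral μ g = c * tvNorm μ := by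
  rw [dotIntegral_eq_integral_inner (integrable_of_norm_le hm hC)]
  have : (fun x => inner ℝ (g x) (polarDensity μ x)) =ᵐ[μ.variation] fun _ => c := by
    filter_upwards [h, norm_polarDensity_ae μ] with x hx h1
    rw [hx, inner_smul_left, real_inner_self_eq_norm_sq, h1]; simp
  rw [integral_congr_ae this, integral_const, smul_eq_mul, mul_comm, tvNorm]

end PolarDecomposition

/-! ### Riesz representation of signed functionals on a compact space -/

section Riesz

variable {X : Type*} [TopologicalSpace X]

/-- The positive part of a linear functional, evaluated on nonnegative functions. -/
def functionalPosPart (l : C(X, ℝ) →L[ℝ] ℝ) (f : C(X, ℝ)) : ℝ := sSup (l '' Set.Icc 0 f)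

theorem functionalPosPart_le (l : C(X, ℝ) →L[ℝ] ℝ) {f : C(X, ℝ)} (hf : 0 ≤ f) {b : ℝ}
    (h : ∀ g, 0 ≤ g → g ≤ f → l g ≤ b) : functionalPosPart l f ≤ b := by
  refine csSup_le ((Set.nonempty_Icc.2 hf).image l) ?_
  rintro _ ⟨g, hg, rfl⟩
  exact h g hg.1 hg.2

variable [CompactSpace X]

theorem bddAbove_image_Icc (l : C(X, ℝ) →L[ℝ] ℝ) (f : C(X, ℝ)) :
    BddAbove (l '' Set.Icc 0 f) := by
  refine ⟨‖l‖ * ‖f‖, ?_⟩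
  rintro _ ⟨g, hg, rfl⟩
  refine (le_abs_self _).trans ((l.le_opNorm g).trans ?_)
  gcongr
  rw [ContinuousMap.norm_le _ (norm_nonneg _)]
  intro x
  refine (Real.norm_of_nonneg (hg.1 x)).le.trans ?_
  exact (hg.2 x).trans ((le_abs_self _).trans (f.norm_coe_le_norm x))

theorem le_functionalPosPart (l : C(X, ℝ) →L[ℝ] ℝ) {f g : C(X, ℝ)} (h0 : 0 ≤ g) (h : g ≤ f) :
    l g ≤ functionalPosPart l f :=
  le_csSup (bddAbove_image_Icc l f) ⟨g, ⟨h0, h⟩, rfl⟩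

/-- Riesz decomposition: any `0 ≤ k ≤ f + g` splits as `k ⊓ f`, below `f`, plus `k - k ⊓ f`, below
`g`. -/
theorem functionalPosPart_add (l : C(X, ℝ) →L[ℝ] ℝ) {f g : C(X, ℝ)} (hf : 0 ≤ f) (hg : 0 ≤ g) :
    functionalPosPart l (f + g) = functionalPosPart l f + functionalPosPart l g := by
  refine le_antisymm (functionalPosPart_le l (add_nonneg hf hg) fun k hk hkfg => ?_) ?_
  · have h1 : l k = l (k ⊓ f) + l (k - k ⊓ f) := by rw [← map_add]; congr 1; abel
    rw [h1]
    refine add_le_add (le_functionalPosPart l (le_inf hk hf) inf_le_right)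
      (le_functionalPosPart l (sub_nonneg.2 inf_le_left) fun x => ?_)
    have h2 : k x ≤ f x + g x := hkfg x
    have h3 : 0 ≤ g x := hg x
    change k x - min (k x) (f x) ≤ g x
    rcases le_total (k x) (f x) with h | h
    · rw [min_eq_left h]; linarith
    · rw [min_eq_right h]; linarith
  · rw [← le_sub_iff_add_le]
    refine functionalPosPart_le l hf fun k hk hkf => ?_
    rw [le_sub_comm]
    refine functionalPosPart_le l hg fun k' hk' hkg => ?_
    rw [le_sub_iff_add_le, add_comm, ← map_add]
    exact le_functionalPosPart l (add_nonneg hk hk') (add_le_add hkf hkg)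

theorem functionalPosPart_smul (l : C(X, ℝ) →L[ℝ] ℝ) {f : C(X, ℝ)} (hf : 0 ≤ f) {c : ℝ}
    (hc : 0 ≤ c) : functionalPosPart l (c • f) = c * functionalPosPart l f := by
  rcases hc.eq_or_lt with rfl | hc
  · have h := functionalPosPart_add l (le_refl (0 : C(X, ℝ))) le_rfl
    rw [add_zero] at h
    rw [zero_smul, zero_mul]
    linarith
  · refine le_antisymm (functionalPosPart_le l (smul_nonneg hc.le hf) fun g hg hgf => ?_) ?_
    · have h1 : l g = c * l (c⁻¹ • g) := by
        rw [map_smul, smul_eq_mul, mul_inv_cancel_left₀ hc.ne']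
      rw [h1]
      refine mul_le_mul_of_nonneg_left (le_functionalPosPart l (smul_nonneg (inv_nonneg.2 hc.le) hg)
        ?_) hc.le
      rwa [inv_smul_le_iff_of_pos hc]
    · rw [mul_comm, ← le_div_iff₀ hc]
      refine functionalPosPart_le l hf fun g hg hgf => ?_
      rw [le_div_iff₀ hc, mul_comm, ← smul_eq_mul, ← map_smul]
      exact le_functionalPosPart l (smul_nonneg hc.le hg) (smul_le_smul_of_nonneg_left hgf hc.le)

variable [T2Space X] [MeasurableSpace X] [BorelSpace X]

theorem exists_measure_of_additive_of_nonneg (T : C(X, ℝ) → ℝ) (h0 : ∀ f, 0 ≤ f → 0 ≤ T f)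
    (hadd : ∀ f g, 0 ≤ f → 0 ≤ g → T (f + g) = T f + T g)
    (hsmul : ∀ (c : ℝ) f, 0 ≤ c → 0 ≤ f → T (c • f) = c * T f) :
    ∃ a : Measure X, IsFiniteMeasure a ∧ ∀ f : C(X, ℝ), 0 ≤ f → T f = ∫ x, f x ∂a := by
  have hnn (f : CompactlySupportedContinuousMap X NNReal) : 0 ≤ f.toReal.toContinuousMap :=
    fun x => (f x).coe_nonneg.trans_eq (CompactlySupportedContinuousMap.toReal_apply f x).symm
  let L : CompactlySupportedContinuousMap X NNReal →ₗ[NNReal] NNReal :=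
    { toFun f := ⟨T f.toReal.toContinuousMap, h0 _ (hnn f)⟩
      map_add' f g := NNReal.eq (by
        refine Eq.trans ?_ (hadd _ _ (hnn f) (hnn g))
        change T _ = T _
        congr 1
        ext x
        simp)
      map_smul' c f := NNReal.eq (by
        refine Eq.trans ?_ (hsmul c _ c.2 (hnn f))
        change T _ = T _
        congr 1
        ext x
        simp [NNReal.smul_def]) }
  refine ⟨NNRealRMK.rieszMeasure L, inferInstance, fun f hf => ?_⟩
  let F : CompactlySupportedContinuousMap X NNReal :=
    ⟨⟨fun x => (f x).toNNReal, by fun_prop⟩, HasCompactSupport.of_compactSpace _⟩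
  have hF : ∀ x, ((F x : NNReal) : ℝ) = f x := fun x => Real.coe_toNNReal _ (hf x)
  have h := NNRealRMK.integral_rieszMeasure L F
  simp only [hF] at h
  rw [h]
  change T f = T _
  congr 1
  ext x
  exact (hF x).symm.trans (CompactlySupportedContinuousMap.toReal_apply F x).symm

/-- Jordan decomposition: on the nonnegative cone `l = l⁺ - (l⁺ - l)` is a difference of nonnegative
additive functionals. The formula extends to all `f` by `f = f ⊔ 0 - (f ⊔ 0 - f)`. -/
theorem exists_measure_sub_measure (l : C(X, ℝ) →L[ℝ] ℝ) :
    ∃ a b : Measure X, IsFiniteMeasure a ∧ IsFiniteMeasure b ∧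
      ∀ f : C(X, ℝ), l f = ∫ x, f x ∂a - ∫ x, f x ∂b := by
  obtain ⟨a, ha, hla⟩ := exists_measure_of_additive_of_nonneg (functionalPosPart l)
    (fun f hf => by simpa using le_functionalPosPart l le_rfl hf)
    (fun f g => functionalPosPart_add l) (fun c f hc hf => functionalPosPart_smul l hf hc)
  obtain ⟨b, hb, hlb⟩ := exists_measure_of_additive_of_nonneg (fun f => functionalPosPart l f - l f)
    (fun f hf => sub_nonneg.2 (le_functionalPosPart l hf le_rfl))
    (fun f g hf hg => by rw [functionalPosPart_add l hf hg, map_add]; ring)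
    (fun c f hc hf => by rw [functionalPosPart_smul l hf hc, map_smul, smul_eq_mul]; ring)
  have hpos : ∀ f : C(X, ℝ), 0 ≤ f → l f = ∫ x, f x ∂a - ∫ x, f x ∂b := by
    intro f hf
    rw [← hla f hf, ← hlb f hf]; ring
  have hint (c : Measure X) [IsFiniteMeasure c] (f : C(X, ℝ)) : Integrable f c :=
    f.continuous.integrable_of_hasCompactSupport (HasCompactSupport.of_compactSpace _)
  refine ⟨a, b, ha, hb, fun f => ?_⟩
  have h (c : Measure X) [IsFiniteMeasure c] :
      ∫ x, (f ⊔ 0 - f) x ∂c = ∫ x, (f ⊔ 0) x ∂c - ∫ x, f x ∂c :=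
    integral_sub (hint c (f ⊔ 0)) (hint c f)
  have hf : l f = l (f ⊔ 0) - l (f ⊔ 0 - f) := by rw [← map_sub, sub_sub_cancel]
  rw [hf, hpos _ le_sup_right, hpos _ (sub_nonneg.2 le_sup_left), h a, h b]
  ring

end Riesz

/-! ### Vector measures as the dual of continuous functions -/

section TotalVariation

variable {X : Type*} [TopologicalSpace X] [CompactSpace X] [MeasurableSpace X] [BorelSpace X]
  {N : ℕ}

theorem pairing_withDensityᵥ_const (a : Measure X) [IsFiniteMeasure a] (v : E N) (φ : C(X, E N)) :
    pairing X N (a.withDensityᵥ fun _ => v) φ = ∫ x, inner ℝ (φ x) v ∂a :=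
  dotIntegral_withDensityᵥ (integrable_const v) (integrable_continuousMap _ φ)

theorem pairing_le (ν : VectorMeasure X (E N)) (φ : C(X, E N)) :
    pairing X N ν φ ≤ ‖φ‖ * tvNorm ν :=
  dotIntegral_le_of_norm_le φ.norm_coe_le_norm

/-- Radial truncation to the unit ball moves `v` by at most `‖v‖ - 1 ≤ ‖v‖ - ‖u‖` when `‖v‖ ≥ 1`. It
turns `L¹` approximants of the polar density into test functions of sup norm at most 1. -/
theorem norm_sub_truncation_le {u v : E N} (hu : ‖u‖ ≤ 1) :
    ‖u - (max 1 ‖v‖)⁻¹ • v‖ ≤ 2 * ‖u - v‖ := by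
  have h1 : ‖v - (max 1 ‖v‖)⁻¹ • v‖ ≤ ‖u - v‖ := by
    rcases le_total ‖v‖ 1 with h | h
    · simp [max_eq_left h]
    · rw [max_eq_right h]
      have hv : ‖v‖ ≠ 0 := by linarith
      have h2 : v - ‖v‖⁻¹ • v = (1 - ‖v‖⁻¹) • v := by rw [sub_smul, one_smul]
      have h3 : ‖v‖⁻¹ ≤ 1 := inv_le_one_of_one_le₀ h
      rw [h2, norm_smul, Real.norm_of_nonneg (by linarith), sub_mul, one_mul, inv_mul_cancel₀ hv]
      have := norm_sub_norm_le v u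
      rw [norm_sub_rev] at this
      linarith
  have h2 : u - (max 1 ‖v‖)⁻¹ • v = (u - v) + (v - (max 1 ‖v‖)⁻¹ • v) := by abel
  rw [h2]
  linarith [norm_add_le (u - v) (v - (max 1 ‖v‖)⁻¹ • v)]

/-- Every continuous functional on the continuous `ℝᴺ`-valued functions is integration against a
vector measure. -/
theorem exists_vectorMeasure_pairing_eq [T2Space X] (l : C(X, E N) →L[ℝ] ℝ) :
    ∃ ν : VectorMeasure X (E N), ∀ φ, pairing X N ν φ = l φ := by
  let e (i : Fin N) : E N := EuclideanSpace.single i 1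
  let J (i : Fin N) : C(X, ℝ) →L[ℝ] C(X, E N) :=
    (ContinuousLinearMap.toSpanSingleton ℝ (e i)).compLeftContinuous ℝ X
  choose a b ha hb hab using fun i => exists_measure_sub_measure (l ∘L J i)
  refine ⟨∑ i, ((a i).withDensityᵥ (fun _ => e i) - (b i).withDensityᵥ fun _ => e i), fun φ => ?_⟩
  let c (i : Fin N) : C(X, ℝ) := ⟨fun x => φ x i, by fun_prop⟩
  have hφ : φ = ∑ i, J i (c i) := by
    ext x j
    simp [J, c, e, Pi.single_apply]
  have hc (i : Fin N) (x : X) : inner ℝ (φ x) (e i) = c i x := by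
    simp [e, c, EuclideanSpace.inner_single_right]
  rw [map_sum, LinearMap.sum_apply]
  conv_rhs => rw [hφ, map_sum]
  refine Finset.sum_congr rfl fun i _ => ?_
  rw [map_sub, LinearMap.sub_apply, pairing_withDensityᵥ_const, pairing_withDensityᵥ_const]
  simp only [hc]
  exact (hab i (c i)).symm

variable [TopologicalSpace.PseudoMetrizableSpace X]

/-- The total variation norm is the dual norm. -/
theorem tvNorm_le_of_pairing_le {ν : VectorMeasure X (E N)} {C : ℝ}
    (h : ∀ φ : C(X, E N), ‖φ‖ ≤ 1 → pairing X N ν φ ≤ C) : tvNorm ν ≤ C := by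
  refine le_of_forall_pos_le_add fun ε hε => ?_
  have hu := integrable_polarDensity ν
  obtain ⟨g, hg, hgi⟩ := hu.exists_boundedContinuous_integral_sub_le (half_pos hε)
  let φ : C(X, E N) := ⟨fun x => (max 1 ‖g x‖)⁻¹ • g x, by
    refine ((continuous_const.max g.continuous.norm).inv₀ fun x => ?_).smul g.continuous
    exact (lt_of_lt_of_le one_pos (le_max_left _ _)).ne'⟩
  have hφ1 : ‖φ‖ ≤ 1 := by
    rw [ContinuousMap.norm_le _ zero_le_one]
    intro x
    change ‖(max 1 ‖g x‖)⁻¹ • g x‖ ≤ 1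
    have hm : 0 < max 1 ‖g x‖ := lt_of_lt_of_le one_pos (le_max_left _ _)
    rw [norm_smul, norm_inv, Real.norm_of_nonneg hm.le, inv_mul_le_iff₀ hm, mul_one]
    exact le_max_right _ _
  have hφi : Integrable φ ν.variation := integrable_continuousMap ν φ
  have hd : Integrable (fun x => ‖polarDensity ν x - φ x‖) ν.variation := (hu.sub hφi).norm
  have hdg : Integrable (fun x => ‖polarDensity ν x - g x‖) ν.variation := (hu.sub hgi).norm
  have hip : Integrable (fun x => inner ℝ (φ x) (polarDensity ν x)) ν.variation := by
    refine hφi.norm.mono' (hφi.aestronglyMeasurable.inner hu.aestronglyMeasurable) ?_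
    filter_upwards [norm_polarDensity_ae ν] with x hx
    exact (norm_inner_le_norm _ _).trans (by rw [hx, mul_one])
  have h1 : pairing X N ν φ = ∫ x, inner ℝ (φ x) (polarDensity ν x) ∂ν.variation :=
    dotIntegral_eq_integral_inner hφi
  have h2 : ∫ x, ‖polarDensity ν x - φ x‖ ∂ν.variation ≤ ε := by
    have : ∫ x, ‖polarDensity ν x - φ x‖ ∂ν.variation ≤
        ∫ x, 2 * ‖polarDensity ν x - g x‖ ∂ν.variation := by
      refine integral_mono_ae hd (hdg.const_mul 2) ?_
      filter_upwards [norm_polarDensity_ae ν] with x hx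
      exact norm_sub_truncation_le hx.le
    rw [integral_const_mul] at this
    linarith
  -- Pointwise `1 = ⟨u, u⟩ = ⟨φ, u⟩ + ⟨u - φ, u⟩ ≤ ⟨φ, u⟩ + ‖u - φ‖`.
  have h3 : tvNorm ν ≤ ∫ x, (inner ℝ (φ x) (polarDensity ν x) + ‖polarDensity ν x - φ x‖)
      ∂ν.variation := by
    have h4 : tvNorm ν = ∫ _, (1 : ℝ) ∂ν.variation := by simp [tvNorm]
    rw [h4]
    refine integral_mono_ae (integrable_const _) (hip.add hd) ?_
    filter_upwards [norm_polarDensity_ae ν] with x hx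
    have h5 := real_inner_le_norm (polarDensity ν x - φ x) (polarDensity ν x)
    rw [inner_sub_left, real_inner_self_eq_norm_sq, hx] at h5
    linarith
  rw [integral_add hip hd, ← h1] at h3
  linarith [h φ hφ1]

end TotalVariation

/-! ### Annihilators and the quotient norm -/

section Duality

variable {X : Type*} [TopologicalSpace X] [CompactSpace X] [MeasurableSpace X] [BorelSpace X]
  {N : ℕ}

/-- A weak-star closed subspace contains every measure that its annihilator does not see. -/
theorem mem_of_forall_annihilator {V : Submodule ℝ (VectorMeasure X (E N))}
    (hV : IsClosed[weakStar X N] (V : Set (VectorMeasure X (E N)))) {ν : VectorMeasure X (E N)}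
    (h : ∀ p ∈ annihilator V, pairing X N ν p = 0) : ν ∈ V := by
  by_contra hν
  obtain ⟨L, u, hL, hu⟩ := geometric_hahn_banach_closed_point (E := WeakBilin (pairing X N))
    V.convex hV hν
  obtain ⟨p, rfl⟩ := LinearMap.dualEmbedding_surjective (pairing X N) L
  change ∀ a ∈ V, pairing X N a p < u at hL
  change u < pairing X N ν p at hu
  have h0 : 0 < u := by simpa using hL 0 V.zero_mem
  have hp : p ∈ annihilator V := by
    intro a ha
    by_contra hne
    -- A functional bounded above on a subspace vanishes there: otherwise a multiple of `a` attains
    -- the excluded value `u`.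
    have := hL ((u / pairing X N a p) • a) (V.smul_mem _ ha)
    rw [map_smul, LinearMap.smul_apply, smul_eq_mul, div_mul_cancel₀ _ hne] at this
    exact this.false
  linarith [h p hp]

/-- A functional norming the class of `q` modulo `V^⊥` is given by a measure `ν` with `‖ν‖ ≤ 1`. It
kills `V^⊥`, so `ν ∈ V` by closedness, and the hypothesis at `ν` bounds the quotient norm of `q` by
`C`. -/
theorem exists_mem_annihilator_norm_add_lt [T2Space X] [TopologicalSpace.PseudoMetrizableSpace X]
    {V : Submodule ℝ (VectorMeasure X (E N))}
    (hV : IsClosed[weakStar X N] (V : Set (VectorMeasure X (E N)))) {q : C(X, E N)} {C : ℝ}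
    (hC : 0 ≤ C) (h : ∀ ν ∈ V, pairing X N ν q ≤ C * tvNorm ν) {ε : ℝ} (hε : 0 < ε) :
    ∃ p ∈ annihilator V, ‖q + p‖ < C + ε := by
  obtain ⟨g, hg, hgq⟩ := exists_dual_vector'' ℝ (Submodule.Quotient.mk q : C(X, E N) ⧸ annihilator V)
  have hbound (φ : C(X, E N)) : g (Submodule.Quotient.mk φ) ≤ ‖φ‖ :=
    (le_abs_self _).trans ((g.le_of_opNorm_le hg _).trans
      (by rw [one_mul]; exact Submodule.Quotient.norm_mk_le _ φ))
  let l : C(X, E N) →L[ℝ] ℝ := LinearMap.mkContinuous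
    (g.toLinearMap ∘ₗ (annihilator V).mkQ) 1 fun φ => by
      refine (g.le_of_opNorm_le hg _).trans ?_
      gcongr
      exact Submodule.Quotient.norm_mk_le _ φ
  have hl (φ : C(X, E N)) : l φ = g (Submodule.Quotient.mk φ) := rfl
  obtain ⟨ν, hν⟩ := exists_vectorMeasure_pairing_eq l
  have hν1 : tvNorm ν ≤ 1 := tvNorm_le_of_pairing_le fun φ hφ => by
    rw [hν, hl]; exact (hbound φ).trans hφ
  have hνV : ν ∈ V := mem_of_forall_annihilator hV fun p hp => by
    rw [hν, hl, (Submodule.Quotient.mk_eq_zero _).2 hp, map_zero]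
  have h1 : ‖(Submodule.Quotient.mk q : C(X, E N) ⧸ annihilator V)‖ ≤ C := by
    have h2 := h ν hνV
    rw [hν, hl, hgq] at h2
    exact h2.trans (mul_le_of_le_one_right hC hν1)
  obtain ⟨m, hm, hmlt⟩ := Submodule.Quotient.norm_mk_lt
    (Submodule.Quotient.mk q : C(X, E N) ⧸ annihilator V) hε
  refine ⟨m - q, (Submodule.Quotient.eq _).1 hm, ?_⟩
  rw [add_sub_cancel]
  linarith

end Duality

/-! ### First-order optimality -/

section Optimality

variable {X : Type*} [MeasurableSpace X] {N : ℕ} {H : Type*} [NormedAddCommGroup H]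
  [InnerProductSpace ℝ H] {A : VectorMeasure X (E N) →ₗ[ℝ] H} {lam : ℝ} {f : H}
  {V : Submodule ℝ (VectorMeasure X (E N))} {μ : VectorMeasure X (E N)}

theorem norm_sub_sq_eq_of_map (η : VectorMeasure X (E N)) :
    ‖f - A η‖ ^ 2 = ‖f - A μ‖ ^ 2 - 2 * inner ℝ (f - A μ) (A η - A μ) + ‖A η - A μ‖ ^ 2 := by
  rw [← norm_sub_sq_real]
  congr 2
  abel

/-- First-order optimality on a subspace. -/
theorem isMinOn_objective_iff (hlam : 0 < lam) (hμ : μ ∈ V) :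
    IsMinOn (objective A lam f) V μ ↔
      (∀ ν ∈ V, inner ℝ (f - A μ) (A ν) ≤ lam / 2 * tvNorm ν) ∧
        inner ℝ (f - A μ) (A μ) = lam / 2 * tvNorm μ := by
  constructor
  · intro hmin
    have key : ∀ η ∈ V, inner ℝ (f - A μ) (A η) - inner ℝ (f - A μ) (A μ) ≤
        lam / 2 * (tvNorm η - tvNorm μ) := by
      intro η hη
      -- Compare `μ` with `(1 - t)μ + tη`, divide by `t` and let `t → 0`; the quadratic remainder
      -- disappears.
      have hseg : ∀ t : ℝ, 0 < t → t ≤ 1 →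
          2 * (inner ℝ (f - A μ) (A η) - inner ℝ (f - A μ) (A μ)) ≤
            lam * (tvNorm η - tvNorm μ) + t * ‖A η - A μ‖ ^ 2 := by
        intro t ht ht1
        have hmem : (1 - t) • μ + t • η ∈ V := V.add_mem (V.smul_mem _ hμ) (V.smul_mem _ hη)
        have h1 := isMinOn_iff.1 hmin _ hmem
        have h2 : A ((1 - t) • μ + t • η) - A μ = t • (A η - A μ) := by
          rw [map_add, map_smul, map_smul, sub_smul, one_smul, smul_sub]; abel
        have h3 : tvNorm ((1 - t) • μ + t • η) ≤ (1 - t) * tvNorm μ + t * tvNorm η := by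
          refine (tvNorm_add_le _ _).trans (le_of_eq ?_)
          rw [tvNorm_smul, tvNorm_smul, abs_of_pos ht, abs_of_nonneg (by linarith)]
        rw [objective, objective, norm_sub_sq_eq_of_map (μ := μ) ((1 - t) • μ + t • η), h2,
          inner_smul_right, norm_smul, Real.norm_of_nonneg ht.le, inner_sub_right] at h1
        have h4 := mul_le_mul_of_nonneg_left h3 hlam.le
        have h5 : 0 ≤ t * (lam * (tvNorm η - tvNorm μ) + t * ‖A η - A μ‖ ^ 2 -
            2 * (inner ℝ (f - A μ) (A η) - inner ℝ (f - A μ) (A μ))) := by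
          nlinarith
        linarith [nonneg_of_mul_nonneg_right h5 ht]
      have hlim : Tendsto (fun t : ℝ => lam * (tvNorm η - tvNorm μ) + t * ‖A η - A μ‖ ^ 2)
          (𝓝[>] 0) (𝓝 (lam * (tvNorm η - tvNorm μ) + 0 * ‖A η - A μ‖ ^ 2)) :=
        ((by fun_prop : Continuous fun t : ℝ => lam * (tvNorm η - tvNorm μ) + t * ‖A η - A μ‖ ^ 2).tendsto
          0).mono_left nhdsWithin_le_nhds
      have h6 := ge_of_tendsto hlim (by
        filter_upwards [Ioc_mem_nhdsGT one_pos] with t ht using hseg t ht.1 ht.2)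
      linarith
    -- The competitors `0` and `2μ` give the two inequalities of the equality at `μ`.
    have hle := key 0 V.zero_mem
    have hge := key ((2 : ℝ) • μ) (V.smul_mem _ hμ)
    rw [map_zero, inner_zero_right, tvNorm_zero] at hle
    rw [map_smul, inner_smul_right, tvNorm_smul, abs_two] at hge
    have heq : inner ℝ (f - A μ) (A μ) = lam / 2 * tvNorm μ := by linarith
    exact ⟨fun ν hν => by linarith [key ν hν], heq⟩
  · rintro ⟨hle, heq⟩
    refine isMinOn_iff.2 fun η hη => ?_
    rw [objective, objective, norm_sub_sq_eq_of_map (μ := μ) η, inner_sub_right]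
    nlinarith [hle η hη, sq_nonneg ‖A η - A μ‖]

end Optimality

/-! ### Weak-star closed subspaces -/

section CriticalPoint

variable {X : Type*} [TopologicalSpace X] [CompactSpace X] [MeasurableSpace X] [BorelSpace X]
  {N : ℕ} {H : Type*} [NormedAddCommGroup H] [InnerProductSpace ℝ H]
  {A : VectorMeasure X (E N) →ₗ[ℝ] H} {hA : WeakStarContinuous A} {lam : ℝ} {f : H}
  {V : Submodule ℝ (VectorMeasure X (E N))} {μ : VectorMeasure X (E N)}

theorem pairing_adjoint_add (h : H) {p : C(X, E N)} (hp : p ∈ annihilator V)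
    {ν : VectorMeasure X (E N)} (hν : ν ∈ V) :
    pairing X N ν (adjoint hA h + p) = inner ℝ h (A ν) := by
  rw [map_add, hp ν hν, add_zero, pairing_adjoint]

/-- Convergence of the sup norms gives the inequality on `V`; `L¹` convergence gives the equality at
`μ`, as `‖u_μ‖ = 1` almost everywhere. -/
theorem ApproxCriticalPoint.isMinOn (hlam : 0 < lam) (hμ : μ ∈ V)
    (h : ApproxCriticalPoint hA lam f V μ) : IsMinOn (objective A lam f) V μ := by
  obtain ⟨p, hp, h1, h2⟩ := h
  refine (isMinOn_objective_iff hlam hμ).2 ⟨fun ν hν => ?_, ?_⟩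
  · refine ge_of_tendsto' (h2.mul_const _) fun n => ?_
    rw [← pairing_adjoint_add (hA := hA) (f - A μ) (hp n) hν]
    exact pairing_le _ _
  · have hu := integrable_polarDensity μ
    have h3 := (ENNReal.tendsto_toReal ENNReal.zero_ne_top).comp h1
    refine sub_eq_zero.1 (norm_le_zero_iff.1 (ge_of_tendsto' h3 fun n => ?_))
    set q := adjoint hA (f - A μ) + p n with hq
    have hqi : Integrable q μ.variation := integrable_continuousMap μ q
    have hip : Integrable (fun x => inner ℝ (q x) (polarDensity μ x)) μ.variation := by
      refine hqi.norm.mono' (hqi.aestronglyMeasurable.inner hu.aestronglyMeasurable) ?_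
      filter_upwards [norm_polarDensity_ae μ] with x hx
      exact (norm_inner_le_norm _ _).trans (by rw [hx, mul_one])
    have h4 : inner ℝ (f - A μ) (A μ) - lam / 2 * tvNorm μ =
        ∫ x, (inner ℝ (q x) (polarDensity μ x) - lam / 2) ∂μ.variation := by
      rw [integral_sub hip (integrable_const _), ← dotIntegral_eq_integral_inner hqi,
        integral_const, smul_eq_mul, mul_comm (μ.variation.real _), tvNorm,
        ← pairing_adjoint_add (hA := hA) (f - A μ) (hp n) hμ]
      rfl
    have hd := integrable_sub_smul_polarDensity hqi (lam / 2)
    have h5 : ENNReal.toReal (eLpNorm (fun x => adjoint hA (f - A μ) x + p n x -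
        (lam / 2) • polarDensity μ x) 1 μ.variation) =
        ∫ x, ‖q x - (lam / 2) • polarDensity μ x‖ ∂μ.variation :=
      toReal_eLpNorm_sub_smul_polarDensity hqi (lam / 2)
    rw [h4, Function.comp_apply, h5]
    refine norm_integral_le_of_norm_le hd.norm ?_
    filter_upwards [norm_polarDensity_ae μ] with x hx
    have h6 : inner ℝ (q x) (polarDensity μ x) - lam / 2 =
        inner ℝ (q x - (lam / 2) • polarDensity μ x) (polarDensity μ x) := by
      rw [inner_sub_left, inner_smul_left, real_inner_self_eq_norm_sq, hx]; simp
    rw [h6]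
    exact (norm_inner_le_norm _ _).trans (by rw [hx, mul_one])

/-- Moving along a line in a normed space, every norm between the given one and infinity occurs. -/
theorem exists_norm_add_smul_eq {F : Type*} [NormedAddCommGroup F] [NormedSpace ℝ F] {x y : F}
    (hy : y ≠ 0) {c : ℝ} (hc : ‖x‖ ≤ c) : ∃ t : ℝ, ‖x + t • y‖ = c := by
  have hcont : Continuous fun t : ℝ => ‖x + t • y‖ := by fun_prop
  have hy' : 0 < ‖y‖ := norm_pos_iff.2 hy
  have hc0 : 0 ≤ c := (norm_nonneg _).trans hc
  set T : ℝ := 2 * c / ‖y‖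
  have hT : 0 ≤ T := by positivity
  have h1 : c ≤ ‖x + T • y‖ := by
    have h2 : ‖T • y‖ = 2 * c := by
      rw [norm_smul, Real.norm_of_nonneg hT, div_mul_cancel₀ _ hy'.ne']
    have h3 := norm_sub_norm_le (T • y) (-x)
    rw [norm_neg, h2, sub_neg_eq_add, add_comm (T • y)] at h3
    linarith
  obtain ⟨t, -, ht⟩ := intermediate_value_Icc hT hcont.continuousOn
    (show c ∈ Set.Icc ‖x + (0 : ℝ) • y‖ ‖x + T • y‖ from ⟨by simpa using hc, h1⟩)
  exact ⟨t, ht⟩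

/-- Duality only gives norms at most `λ/2 + ε`; `hne` is what keeps them from falling below `λ/2`.
If `μ ≠ 0`, pairing with `μ` forbids it; if `μ = 0`, then `V^⊥ ≠ 0` and a nonzero annihilator raises
the norm to `λ/2`. -/
theorem approxCriticalPoint_of_isMinOn [T2Space X] [TopologicalSpace.PseudoMetrizableSpace X]
    (hlam : 0 < lam) (hV : IsClosed[weakStar X N] (V : Set (VectorMeasure X (E N)))) (hμ : μ ∈ V)
    (hne : μ ≠ 0 ∨ V ≠ ⊤) (hmin : IsMinOn (objective A lam f) V μ) :
    ApproxCriticalPoint hA lam f V μ := by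
  obtain ⟨hle, heq⟩ := (isMinOn_objective_iff hlam hμ).1 hmin
  set q := adjoint hA (f - A μ)
  have hq : ∀ ν ∈ V, pairing X N ν q ≤ lam / 2 * tvNorm ν := fun ν hν => by
    rw [pairing_adjoint]; exact hle ν hν
  have hex : ∀ ε : ℝ, 0 < ε →
      ∃ p ∈ annihilator V, lam / 2 ≤ ‖q + p‖ ∧ ‖q + p‖ ≤ lam / 2 + ε := by
    intro ε hε
    obtain ⟨p, hp, hpε⟩ := exists_mem_annihilator_norm_add_lt hV (half_pos hlam).le hq hε
    rcases le_total (lam / 2) ‖q + p‖ with hlow | hlow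
    · exact ⟨p, hp, hlow, hpε.le⟩
    by_cases hμ0 : μ = 0
    · have hVtop : V ≠ ⊤ := hne.resolve_left (not_not.2 hμ0)
      have hann : annihilator V ≠ ⊥ := fun hbot => hVtop (eq_top_iff.2 fun ν _ =>
        mem_of_forall_annihilator hV fun p hp => by
          rw [hbot, Submodule.mem_bot] at hp
          rw [hp, map_zero])
      obtain ⟨p', hp', hp0⟩ := Submodule.exists_mem_ne_zero_of_ne_bot hann
      obtain ⟨t, ht⟩ := exists_norm_add_smul_eq hp0 hlow
      refine ⟨p + t • p', (annihilator V).add_mem hp ((annihilator V).smul_mem _ hp'), ?_⟩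
      rw [← add_assoc, ht]
      exact ⟨le_rfl, by linarith⟩
    · refine ⟨p, hp, ?_, hpε.le⟩
      have hpos : 0 < tvNorm μ := lt_of_le_of_ne (tvNorm_nonneg μ) fun h =>
        hμ0 (eq_zero_of_tvNorm_eq_zero h.symm)
      have h1 := pairing_le μ (q + p)
      rw [pairing_adjoint_add (f - A μ) hp hμ, heq] at h1
      exact le_of_mul_le_mul_right h1 hpos
  let s (n : ℕ) : ℝ := 1 / ((n : ℝ) + 1)
  have hs0 (n : ℕ) : 0 < s n := Nat.one_div_pos_of_nat
  have hs : Tendsto s atTop (𝓝 0) := tendsto_one_div_add_atTop_nhds_zero_nat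
  -- An excess of `s n ^ 2` in the norm makes the squared `L²` distance of order `s n ^ 2`, so the
  -- parameter `s n` leaves an `L¹` error of order `s n`.
  choose p hp hplow hpup using fun n => hex (s n ^ 2) (pow_pos (hs0 n) 2)
  refine ⟨p, hp, ?_, ?_⟩
  · have hL1 (n : ℕ) : eLpNorm (fun x => q x + p n x - (lam / 2) • polarDensity μ x) 1 μ.variation ≤
        ENNReal.ofReal (s n * ((1 + lam + s n ^ 2) / 2 * tvNorm μ)) := by
      have hdot : dotIntegral μ (fun x => q x + p n x) = lam / 2 * tvNorm μ :=
        (pairing_adjoint_add (f - A μ) (hp n) hμ).trans heq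
      refine (eLpNorm_sub_polarDensity_le (μ := μ) (g := fun x => q x + p n x)
        (C := lam / 2 + s n ^ 2) (q + p n).continuous.measurable
        (fun x => ((q + p n).norm_coe_le_norm x).trans (hpup n)) (hs0 n)).trans (le_of_eq ?_)
      rw [hdot]
      congr 1
      have := (hs0 n).ne'
      field_simp
      ring
    have hlim : Tendsto (fun n => ENNReal.ofReal (s n * ((1 + lam + s n ^ 2) / 2 * tvNorm μ))) atTop
        (𝓝 0) := by
      have h1 : Tendsto (fun n => s n * ((1 + lam + s n ^ 2) / 2 * tvNorm μ)) atTop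
          (𝓝 (0 * ((1 + lam + 0 ^ 2) / 2 * tvNorm μ))) :=
        hs.mul ((((hs.pow 2).const_add _).div_const _).mul_const _)
      rw [zero_mul] at h1
      simpa using ENNReal.tendsto_ofReal h1
    exact tendsto_of_tendsto_of_tendsto_of_le_of_le tendsto_const_nhds hlim (fun _ => zero_le) hL1
  · refine tendsto_of_tendsto_of_tendsto_of_le_of_le tendsto_const_nhds ?_ hplow hpup
    simpa using (hs.pow 2).const_add (lam / 2)

end CriticalPoint

/-! ### Spaces generated by mutually singular measures -/

section GeneratedSpace

variable {X : Type*} [MeasurableSpace X] {N : ℕ} {ι : Type*} [Countable ι]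

/-- Mutually singular measures are concentrated on disjoint measurable sets. -/
theorem exists_disjoint_measurableSet_of_mutuallySingular {ν : ι → Measure X}
    (h : Pairwise fun j k => ν j ⟂ₘ ν k) :
    ∃ S : ι → Set X, (∀ k, MeasurableSet (S k)) ∧ (∀ k, ∀ᵐ x ∂ν k, x ∈ S k) ∧
      Pairwise fun j k => Disjoint (S j) (S k) := by
  -- The null sets chosen for `(j, k)` and `(k, j)` are unrelated, so both are used; disjointness of
  -- `S j` and `S k` then follows from the single pair `(j, k)`.
  let S (k : ι) : Set X := (⋂ (j) (hj : j ≠ k), (h hj).nullSet) ∩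
    ⋂ (j) (hj : k ≠ j), (h hj).nullSetᶜ
  refine ⟨S, fun k => ?_, fun k => ?_, fun j k hjk => ?_⟩
  · exact (MeasurableSet.iInter fun j => MeasurableSet.iInter fun hj =>
      (h hj).measurableSet_nullSet).inter (MeasurableSet.iInter fun j => MeasurableSet.iInter
        fun hj => (h hj).measurableSet_nullSet.compl)
  · have h1 : ∀ᵐ x ∂ν k, ∀ j, ∀ hj : j ≠ k, x ∈ (h hj).nullSet :=
      ae_all_iff.2 fun j => ae_all_iff.2 fun hj => (h hj).measure_compl_nullSet
    have h2 : ∀ᵐ x ∂ν k, ∀ j, ∀ hj : k ≠ j, x ∉ (h hj).nullSet :=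
      ae_all_iff.2 fun j => ae_all_iff.2 fun hj => measure_eq_zero_iff_ae_notMem.1
        (h hj).measure_nullSet
    filter_upwards [h1, h2] with x hx1 hx2
    simp only [S, Set.mem_inter_iff, Set.mem_iInter, Set.mem_compl_iff]
    exact ⟨hx1, hx2⟩
  · refine Set.disjoint_left.2 fun x hj hk => ?_
    simp only [S, Set.mem_inter_iff, Set.mem_iInter, Set.mem_compl_iff] at hj hk
    exact hj.2 k hjk (hk.1 j hjk)

/-- The last clause controls `g` off the sets too, so that bounds on the constants hold at every
point. -/
theorem exists_measurable_eq_const_on {F : Type*} [MeasurableSpace F] [Zero F] {S : ι → Set X}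
    (hS : ∀ k, MeasurableSet (S k)) (hd : Pairwise fun j k => Disjoint (S j) (S k)) (c : ι → F) :
    ∃ g : X → F, Measurable g ∧ (∀ k, ∀ x ∈ S k, g x = c k) ∧ ∀ x, g x = 0 ∨ ∃ k, g x = c k := by
  let T : Option ι → Set X := fun o => o.elim (⋃ k, S k)ᶜ S
  let c' : Option ι → F := fun o => o.elim 0 c
  obtain ⟨g, hg, hgT⟩ := exists_measurable_piecewise T
    (fun o => by
      cases o with
      | none => exact (MeasurableSet.iUnion hS).compl
      | some k => exact hS k)
    (fun o _ => c' o) (fun o => measurable_const) (by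
      intro i j hij x hx
      exfalso
      cases i with
      | none => cases j with
        | none => exact hij rfl
        | some j => exact hx.1 (Set.mem_iUnion.2 ⟨j, hx.2⟩)
      | some i => cases j with
        | none => exact hx.2 (Set.mem_iUnion.2 ⟨i, hx.1⟩)
        | some j => exact Set.disjoint_left.1 (hd fun h => hij (congrArg some h)) hx.1 hx.2)
  refine ⟨g, hg, fun k x hx => hgT (some k) hx, fun x => ?_⟩
  by_cases hx : x ∈ ⋃ k, S k
  · obtain ⟨k, hk⟩ := Set.mem_iUnion.1 hx
    exact Or.inr ⟨k, hgT (some k) hk⟩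
  · exact Or.inl (hgT none hx)

variable {I : Set ℕ} {ν : I → Measure X} [∀ k, IsProbabilityMeasure (ν k)]

theorem withDensityᵥ_const_mem_generatedSpace (k : I) (v : E N) :
    (ν k).withDensityᵥ (fun _ => v) ∈ generatedSpace N ν := by
  classical
  refine ⟨Pi.single k v, summable_of_ne_finset_zero (s := {k}) fun j hj => ?_, fun s hs => ?_⟩
  · rw [Pi.single_eq_of_ne (by simpa using hj), norm_zero]
  · rw [withDensityᵥ_apply (integrable_const v) hs, setIntegral_const]
    have h := hasSum_single (f := fun j => (ν j).real s • (Pi.single k v : I → E N) j) k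
      fun j hj => by rw [Pi.single_eq_of_ne hj, smul_zero]
    simpa using h

theorem tvNorm_withDensityᵥ_const (a : Measure X) [IsProbabilityMeasure a] (v : E N) :
    tvNorm (a.withDensityᵥ fun _ => v) = ‖v‖ := by
  rw [tvNorm, Measure.variation_withDensityᵥ (integrable_const v), withDensity_const]
  simp [measureReal_def]

theorem dotIntegral_withDensityᵥ_const (a : Measure X) [IsProbabilityMeasure a] {φ : X → E N}
    {C : ℝ} (hm : Measurable φ) (hC : ∀ x, ‖φ x‖ ≤ C) (v : E N) :
    dotIntegral (a.withDensityᵥ fun _ => v) φ = inner ℝ (∫ x, φ x ∂a) v := by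
  rw [dotIntegral_withDensityᵥ (integrable_const v) (integrable_of_norm_le hm hC)]
  have hφ : Integrable φ a := Integrable.of_bound hm.aestronglyMeasurable C (Eventually.of_forall hC)
  simp only [real_inner_comm v]
  exact integral_inner hφ v

/-- A bounded function with vanishing integrals against the generators annihilates the generated
space. -/
theorem dotIntegral_eq_zero_of_mem_generatedSpace (hν : Pairwise fun j k => ν j ⟂ₘ ν k)
    {φ : X → E N} {C : ℝ} (hm : Measurable φ) (hC : ∀ x, ‖φ x‖ ≤ C)
    (h0 : ∀ k, ∫ x, φ x ∂ν k = 0) {η : VectorMeasure X (E N)} (hη : η ∈ generatedSpace N ν) :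
    dotIntegral η φ = 0 := by
  obtain ⟨m, hsum, hm'⟩ := hη
  obtain ⟨S, hS, hSν, hd⟩ := exists_disjoint_measurableSet_of_mutuallySingular hν
  obtain ⟨g, hg, hgS, -⟩ := exists_measurable_eq_const_on hS hd m
  have hae (k : I) : g =ᵐ[ν k] fun _ => m k := (hSν k).mono fun x hx => hgS k x hx
  have hgi : Integrable g (Measure.sum ν) := by
    refine integrable_sum_measure (fun k => (integrable_const (m k)).congr (hae k).symm) ?_
    convert hsum using 2 with k
    have h1 : (fun x => ‖g x‖) =ᵐ[ν k] fun _ => ‖m k‖ := (hae k).fun_comp norm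
    rw [integral_congr_ae h1]
    simp
  -- As the `S k` are disjoint, one function equal to `m k` on `S k` is a density of `∑ mₖ νₖ`.
  have hη : (Measure.sum ν).withDensityᵥ g = η := by
    ext1 s hs
    rw [withDensityᵥ_apply hgi hs]
    refine HasSum.unique ?_ (hm' s hs)
    rw [Measure.restrict_sum _ hs]
    have h1 : Integrable g (Measure.sum fun k => (ν k).restrict s) := by
      rw [← Measure.restrict_sum _ hs]; exact hgi.restrict
    have h2 (k : I) : ∫ x in s, g x ∂ν k = (ν k).real s • m k := by
      rw [integral_congr_ae (ae_restrict_of_ae (hae k)), setIntegral_const]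
    simpa only [h2] using hasSum_integral_measure h1
  rw [← hη, dotIntegral_withDensityᵥ hgi (integrable_of_norm_le hm hC)]
  have hi : Integrable (fun x => inner ℝ (φ x) (g x)) (Measure.sum ν) := by
    refine (hgi.norm.const_mul C).mono' (hm.aestronglyMeasurable.inner hgi.aestronglyMeasurable)
      (Eventually.of_forall fun x => ?_)
    exact (norm_inner_le_norm _ _).trans
      (mul_le_mul_of_nonneg_right (hC x) (norm_nonneg _))
  refine HasSum.unique (hasSum_integral_measure hi) ?_
  convert hasSum_zero using 2 with k
  have h2 : (fun x => inner ℝ (φ x) (g x)) =ᵐ[ν k] fun x => inner ℝ (m k) (φ x) := by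
    filter_upwards [hae k] with x hx
    rw [hx, real_inner_comm]
  have hφ : Integrable φ (ν k) :=
    Integrable.of_bound hm.aestronglyMeasurable C (Eventually.of_forall hC)
  rw [integral_congr_ae h2, integral_inner hφ, h0 k, inner_zero_right]

end GeneratedSpace

/-! ### Optimality in generated spaces -/

section GeneratedCriticalPoint

variable {X : Type*} [TopologicalSpace X] [CompactSpace X] [MeasurableSpace X] [BorelSpace X]
  {N : ℕ} {H : Type*} [NormedAddCommGroup H] [InnerProductSpace ℝ H]
  {A : VectorMeasure X (E N) →ₗ[ℝ] H} (hA : WeakStarContinuous A) {lam : ℝ} {f : H}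
  {μ : VectorMeasure X (E N)}

theorem dotIntegral_adjoint_add (h : H) {p : X → E N} {C : ℝ} (hm : Measurable p)
    (hC : ∀ x, ‖p x‖ ≤ C) {ν : VectorMeasure X (E N)} (hp : dotIntegral ν p = 0) :
    dotIntegral ν (fun x => adjoint hA h x + p x) = inner ℝ h (A ν) := by
  have h1 : dotIntegral ν (fun x => adjoint hA h x + p x) =
      dotIntegral ν (adjoint hA h) + dotIntegral ν p :=
    VectorMeasure.integral_add (integrable_continuousMap ν _) (integrable_of_norm_le hm hC)
  rw [h1, hp, add_zero]
  exact pairing_adjoint hA h ν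

theorem isMinOn_of_exists_density {V : Submodule ℝ (VectorMeasure X (E N))} (hlam : 0 < lam)
    (hμ : μ ∈ V) {p : X → E N} (hm : Measurable p) (hp : ∀ η ∈ V, dotIntegral η p = 0)
    (hae : ∀ᵐ x ∂μ.variation, adjoint hA (f - A μ) x + p x = (lam / 2) • polarDensity μ x)
    (hle : ∀ x, ‖adjoint hA (f - A μ) x + p x‖ ≤ lam / 2) :
    IsMinOn (objective A lam f) V μ := by
  set q := adjoint hA (f - A μ) with hq
  have hC (x : X) : ‖p x‖ ≤ lam / 2 + ‖q‖ := by
    have h1 : p x = (q x + p x) - q x := by abel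
    rw [h1]
    exact (norm_sub_le _ _).trans (add_le_add (hle x) (q.norm_coe_le_norm x))
  have hgm : Measurable fun x => q x + p x := q.continuous.measurable.add hm
  refine (isMinOn_objective_iff hlam hμ).2 ⟨fun ν hν => ?_, ?_⟩
  · rw [← dotIntegral_adjoint_add hA (f - A μ) hm hC (hp ν hν)]
    exact dotIntegral_le_of_norm_le hle
  · rw [← dotIntegral_adjoint_add hA (f - A μ) hm hC (hp μ hμ)]
    exact dotIntegral_eq_tvNorm_of_ae_eq hgm hle hae

/-- Measures in the space see `q` only through its means over the `ν k`. Thus `p = g - q`, with `g`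
equal to the mean on each carrier and zero elsewhere, annihilates the space. -/
theorem exists_density_of_isMinOn {I : Set ℕ} {ν : I → Measure X} [∀ k, IsProbabilityMeasure (ν k)]
    (hν : Pairwise fun j k => ν j ⟂ₘ ν k) (hlam : 0 < lam) (hμ : μ ∈ generatedSpace N ν)
    (hmin : IsMinOn (objective A lam f) (generatedSpace N ν) μ) :
    ∃ p : X → E N, Measurable p ∧ MemLp p ∞ (Measure.sum ν) ∧
      (∀ η ∈ generatedSpace N ν, dotIntegral η p = 0) ∧
      (∀ᵐ x ∂μ.variation, adjoint hA (f - A μ) x + p x = (lam / 2) • polarDensity μ x) ∧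
      ∀ x, ‖adjoint hA (f - A μ) x + p x‖ ≤ lam / 2 := by
  obtain ⟨hle, heq⟩ := (isMinOn_objective_iff hlam hμ).1 hmin
  set q := adjoint hA (f - A μ) with hq
  have hqm : Measurable q := q.continuous.measurable
  have hmean (k : I) : ‖∫ x, q x ∂ν k‖ ≤ lam / 2 := by
    set v := ∫ x, q x ∂ν k with hv
    -- Testing with `v ν k`, where `v` is the mean itself, gives `‖v‖² ≤ (λ/2)‖v‖`.
    have h1 := hle _ (withDensityᵥ_const_mem_generatedSpace (ν := ν) k v)
    rw [← pairing_adjoint hA, tvNorm_withDensityᵥ_const] at h1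
    have h2 : pairing X N ((ν k).withDensityᵥ fun _ => v) q = inner ℝ v v :=
      dotIntegral_withDensityᵥ_const (ν k) hqm q.norm_coe_le_norm v
    rw [h2, real_inner_self_eq_norm_sq, sq] at h1
    rcases (norm_nonneg v).eq_or_lt with h0 | h0
    · rw [← h0]; positivity
    · exact le_of_mul_le_mul_right h1 h0
  obtain ⟨S, hS, hSν, hd⟩ := exists_disjoint_measurableSet_of_mutuallySingular hν
  obtain ⟨g, hg, hgS, hg0⟩ := exists_measurable_eq_const_on hS hd fun k => ∫ x, q x ∂ν k
  have hgle (x : X) : ‖g x‖ ≤ lam / 2 := by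
    rcases hg0 x with h | ⟨k, h⟩
    · rw [h, norm_zero]; positivity
    · rw [h]; exact hmean k
  have hpm : Measurable fun x => g x - q x := hg.sub hqm
  have hpC (x : X) : ‖g x - q x‖ ≤ lam / 2 + ‖q‖ :=
    (norm_sub_le _ _).trans (add_le_add (hgle x) (q.norm_coe_le_norm x))
  have hann : ∀ η ∈ generatedSpace N ν, dotIntegral η (fun x => g x - q x) = 0 := by
    refine fun η hη => dotIntegral_eq_zero_of_mem_generatedSpace hν hpm hpC (fun k => ?_) hη
    have hae : g =ᵐ[ν k] fun _ => ∫ x, q x ∂ν k := (hSν k).mono fun x hx => hgS k x hx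
    have hqi : Integrable q (ν k) :=
      Integrable.of_bound hqm.aestronglyMeasurable _ (Eventually.of_forall q.norm_coe_le_norm)
    rw [integral_sub ((integrable_const _).congr hae.symm) hqi, integral_congr_ae hae]
    simp
  have hqg : (fun x => q x + (g x - q x)) = g := by ext1 x; abel
  have hdot : dotIntegral μ g = lam / 2 * tvNorm μ := by
    rw [← heq, ← dotIntegral_adjoint_add hA (f - A μ) hpm hpC (hann μ hμ), hqg]
  obtain ⟨hi, hsq⟩ := integral_norm_sub_polarDensity_sq_le (μ := μ) (c := lam / 2) hg hgle
  -- Here the bound on `g` and the scaling of the polar density are both `λ/2`, so the estimate is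
  -- exactly zero.
  have hzero : ∫ x, ‖g x - (lam / 2) • polarDensity μ x‖ ^ 2 ∂μ.variation = 0 := by
    refine le_antisymm (hsq.trans (le_of_eq ?_)) (integral_nonneg fun x => by positivity)
    rw [hdot]; ring
  rw [integral_eq_zero_iff_of_nonneg (fun x => by positivity) hi] at hzero
  refine ⟨fun x => g x - q x, hpm, memLp_top_of_bound hpm.aestronglyMeasurable _
    (Eventually.of_forall hpC), hann, ?_, fun x => ?_⟩
  · filter_upwards [hzero] with x hx
    rw [add_sub_cancel]
    exact sub_eq_zero.1 (norm_eq_zero.1 (pow_eq_zero_iff two_ne_zero |>.1 hx))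
  · rw [add_sub_cancel]; exact hgle x

end GeneratedCriticalPoint

end TVReg

end

theorem corollary4p3 {N : ℕ} (S : Set (EuclideanSpace ℝ (Fin N))) [CompactSpace S]
    {H : Type*} [NormedAddCommGroup H] [InnerProductSpace ℝ H] [CompleteSpace H]
    (A : VectorMeasure S (TVReg.E N) →ₗ[ℝ] H) (hA : TVReg.WeakStarContinuous A)
    (lam : ℝ) (hlam : 0 < lam) (f : H) :
    -- weak-star closed subspaces
    (∀ V : Submodule ℝ (VectorMeasure S (TVReg.E N)),
      IsClosed[TVReg.weakStar S N] (V : Set (VectorMeasure S (TVReg.E N))) →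
      ∀ μ ∈ V,
        (TVReg.ApproxCriticalPoint hA lam f V μ → IsMinOn (TVReg.objective A lam f) V μ) ∧
        ((μ ≠ 0 ∨ V ≠ ⊤) →
          IsMinOn (TVReg.objective A lam f) V μ → TVReg.ApproxCriticalPoint hA lam f V μ)) ∧
    -- spaces generated by countably many mutually singular probability measures
    (∀ (I : Set ℕ) (ν : I → Measure S), (∀ k, IsProbabilityMeasure (ν k)) →
      Pairwise (fun j k => ν j ⟂ₘ ν k) →
      ∀ μ ∈ TVReg.generatedSpace N ν,
        (IsMinOn (TVReg.objective A lam f) (TVReg.generatedSpace N ν) μ ↔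
          ∃ p : S → TVReg.E N, Measurable p ∧ MemLp p ∞ (Measure.sum ν) ∧
            (∀ η ∈ TVReg.generatedSpace N ν, TVReg.dotIntegral η p = 0) ∧
            (∀ᵐ x ∂μ.variation, TVReg.adjoint hA (f - A μ) x + p x =
              (lam / 2) • TVReg.polarDensity μ x) ∧
            ∀ x, ‖TVReg.adjoint hA (f - A μ) x + p x‖ ≤ lam / 2)) := by
  refine ⟨fun V hV μ hμ => ⟨fun h => h.isMinOn hlam hμ, fun hne hmin =>
    TVReg.approxCriticalPoint_of_isMinOn hlam hV hμ hne hmin⟩, fun I ν hν hsing μ hμ => ⟨fun hmin =>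
    TVReg.exists_density_of_isMinOn hA hsing hlam hμ hmin, ?_⟩⟩
  rintro ⟨p, hm, -, hp, hae, hle⟩
  exact TVReg.isMinOn_of_exists_density hA hlam hμ hm hp hae hle
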